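/- Let $n\ge 1$, $p\ge 2$, let $X$ be a real $n\times p$ matrix and let $Y=f+\varepsilon$, where $f\in\mathbb R^n$ is unknown and $\varepsilon_1,\dots,\varepsilon_n$ are independent centered Gaussian variables with common (unknown) variance $\sigma^2$. Let $\|\cdot\|$ be the Euclidean norm and $\Pi_S$ the orthogonal projection onto a linear subspace $S$ of $\mathbb R^n$. For $m\subset\{1,\dots,p\}$ let $S_m$ be the linear span of the columns of $X$ with index in $m$ ($S_\varnothing=\{0\}$). Let $K>1$, $\kappa\in(0,1)$, $\alpha>0$ and let $D_{\max}\ge 1$ be an integer with $D_{\max}\le n-2$ and $D_{\max}\le \kappa n/(2\log p)$. Put $\mathbb S=\{S_m : |m|\le D_{\max}\}$ and, for $S\in\mathbb S$ with $D=\dim S$, $$\Delta(S)=\log\binom pD+\log(1+D),\qquad \operatorname{pen}(S)=K\operatorname{pen}_\Delta(S),\qquad \widehat\sigma_S^2=\frac{\|Y-\Pi_SY\|^2}{n-D},$$ where $\operatorname{pen}_\Delta(S)\ge 0$ is defined by $$\mathbb E\Big[\Big(U-\frac{\operatorname{pen}_\Delta(S)}{n-D}V\Big)_+\Big]=e^{-\Delta(S)}$$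 with $U,V$ independent $\chi^2$ variables with $D+1$ and $n-D-1$ degrees of freedom. Let $\Lambda$ be a finite set and let $\widehat{\mathcal M}=\{\widehat m(\lambda),\lambda\in\Lambda\}$ be a collection of random subsets of $\{1,\dots,p\}$, based on $Y$, with cardinality at most $D_{\max}$. Let $\widehat f_\lambda=\Pi_{S_{\widehat m(\lambda)}}Y$, and let $\mathbb S_\lambda\subset\mathbb S$ be (possibly random) families, based on $Y$, with $S_{\widehat m(\lambda)}\in\mathbb S_\lambda$. Let $\widehat\lambda=\widehat\lambda(Y)$ be a (measurable) minimizer over $\lambda\in\Lambda$ of $$\operatorname{crit}_\alpha(\widehat f_\lambda)=\inf_{S\in\mathbb S_\lambda}\Big[\|Y-\Pi_S\widehat f_\lambda\|^2+\alpha\|\widehat f_\lambda-\Pi_S\widehat f_\lambda\|^2+\operatorname{pen}(S)\,\widehat\sigma_S^2\Big].$$ If $f\in S_{m^*}$ for some non-void $m^*\subset\{1,\dots,p\}$ with $|m^*|\le D_{\max}$, then $\mathbb E\|f-\widehat f_{\widehat\lambda}\|^2<\infty$ and $$C\,\mathbb E\big[\|f-\widehat f_{\widehat\lambda}\|^2\big]\le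 \log(p)\,|m^*|\,\sigma^2+\big(\|f\|^2+n\sigma^2\big)\,\big(\mathbb P[m^*\notin\widehat{\mathcal M}]\big)^{1/2},$$ where $C>0$ depends on $K$, $\kappa$ and $\alpha$ only. Moreover, if $\mathbb S_\lambda\subset\{S_{\widehat m(\lambda')},\ \lambda'\in\Lambda\}$ for all $\lambda\in\Lambda$, then $C$ can be chosen to depend on $K$ and $\kappa$ only. -/

import Mathlib

open MeasureTheory ProbabilityTheory
open scoped NNReal

noncomputable section

namespace EstimatorSelection

/-- The chi-square distribution with `k` degrees of freedom: the law of the sum of the squares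
of `k` independent standard Gaussian variables. -/
def chiSquare (k : ℕ) : Measure ℝ :=
  (Measure.pi fun _ : Fin k => gaussianReal 0 1).map fun z => ∑ i, z i ^ 2

/-- `E[(U - x / (n - d) * V)₊]` where `U` and `V` are independent chi-square variables with
`d + 1` and `n - d - 1` degrees of freedom. It is only used for `d + 2 ≤ n`. -/
def chiExcess (n d : ℕ) (x : ℝ) : ℝ :=
  ∫ z, max (z.1 - x / ((n : ℝ) - d) * z.2) 0 ∂((chiSquare (d + 1)).prod (chiSquare (n - d - 1)))

/-- The penalty `pen_Δ(S)` of a space of dimension `d` and weight `δ` in `ℝⁿ`: the solution `x ≥ 0`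
of `E[(U - x / (n - d) * V)₊] = exp (-δ)`. For `d + 2 ≤ n` and `0 ≤ δ` the left-hand side is
continuous and strictly decreasing on `x ≥ 0`, from `d + 1` to the limit `0`, so that the set
below has exactly one element. -/
def penDelta (n d : ℕ) (δ : ℝ) : ℝ :=
  sInf {x : ℝ | 0 ≤ x ∧ chiExcess n d x = Real.exp (-δ)}

variable {n p : ℕ}

/-- `S_m`: the linear span in `ℝⁿ` of the columns of `X` with index in `m`. -/
def modelSpace (X : Matrix (Fin n) (Fin p) ℝ) (m : Finset (Fin p)) :
    Submodule ℝ (EuclideanSpace ℝ (Fin n)) :=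
  Submodule.span ℝ ((fun j : Fin p => WithLp.toLp 2 (fun i : Fin n => X i j)) '' (m : Set (Fin p)))

/-- The collection of the spaces `S_m` with `|m| ≤ Dmax`. -/
def modelCollection (X : Matrix (Fin n) (Fin p) ℝ) (Dmax : ℕ) :
    Set (Submodule ℝ (EuclideanSpace ℝ (Fin n))) :=
  {S | ∃ m : Finset (Fin p), m.card ≤ Dmax ∧ S = modelSpace X m}

/-- The weight `Δ(S) = log (p choose D) + log (1 + D)` with `D = dim S`. -/
def weight (p : ℕ) (S : Submodule ℝ (EuclideanSpace ℝ (Fin n))) : ℝ :=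
  Real.log (p.choose (Module.finrank ℝ S)) + Real.log (1 + Module.finrank ℝ S)

/-- The penalty `pen(S) = K pen_Δ(S)`. -/
def penalty (K : ℝ) (p : ℕ) (S : Submodule ℝ (EuclideanSpace ℝ (Fin n))) : ℝ :=
  K * penDelta n (Module.finrank ℝ S) (weight p S)

/-- The variance estimator `‖y - Π_S y‖² / (n - dim S)`. -/
def varEst (S : Submodule ℝ (EuclideanSpace ℝ (Fin n))) (y : EuclideanSpace ℝ (Fin n)) : ℝ :=
  ‖y - S.starProjection y‖ ^ 2 / ((n : ℝ) - Module.finrank ℝ S)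

/-- The criterion `crit_α(g)` of an estimator with value `g` at the observation `y`, the infimum
being taken over the collection `T` of approximation spaces attached to that estimator. -/
def crit (K α : ℝ) (p : ℕ) (T : Set (Submodule ℝ (EuclideanSpace ℝ (Fin n))))
    (y g : EuclideanSpace ℝ (Fin n)) : ℝ :=
  ⨅ S : T, (‖y - S.1.starProjection g‖ ^ 2 + α * ‖g - S.1.starProjection g‖ ^ 2
    + penalty K p S.1 * varEst S.1 y)

/-- The projection estimator `Π_{S_m} y`. -/
def projEst (X : Matrix (Fin n) (Fin p) ℝ) (m : Finset (Fin p))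
    (y : EuclideanSpace ℝ (Fin n)) : EuclideanSpace ℝ (Fin n) :=
  (modelSpace X m).starProjection y

/-- The observation `Y = f + ε`. -/
def observation {Ω : Type*} (f : EuclideanSpace ℝ (Fin n)) (ε : Fin n → Ω → ℝ) (ω : Ω) :
    EuclideanSpace ℝ (Fin n) :=
  f + WithLp.toLp 2 (fun i => ε i ω)

end EstimatorSelection

end

/-! On the event that some λ selects m*, compare the criterion at the minimizer with the criterion
at that λ, which is at most ‖ε‖² + pen(S*) σ̂². Let T be the space attaining the criterion of the
selected g, and W ⊇ T a space containing f with dim W = dim T + 1. Since f - Π_T g lies in W, the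
cross term sees the noise only through Π_W ε, and Young's inequality with parameter K
(`mul_norm_sub_sq_le`) leaves K times (‖Π_W ε‖² - pen_Δ(T)/(n-D) ‖ε - Π_W ε‖²)₊ plus K
pen_Δ(S*)/(n-D*) ‖ε‖² (`mul_norm_sub_sq_add_le`).

By Cochran's theorem and the definition of pen_Δ, the positive part has mean σ² exp(-Δ(T)) for fixed
T (`integral_noiseExcess`). The random T is handled by summing over all models, one linearly
independent index set at a time; the weights make this a harmonic sum of order log p. A Chernoff
bound gives pen_Δ(S*)/(n-D*) = O(|m*| log p / n) (`penDelta_div_le`).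

Off the event, the loss is at most ‖f‖² + ‖ε‖² and Cauchy-Schwarz yields the square root of the
probability. The parameter α serves only to pass from Π_T g to g; when T is itself a selected model,
minimality forces Π_T g = g and α drops out. -/

namespace EstimatorSelection

/-! ### Chi-square laws: exponential moments and mean -/

instance isProbabilityMeasure_chiSquare (k : ℕ) : IsProbabilityMeasure (chiSquare k) :=
  Measure.isProbabilityMeasure_map (Measurable.aemeasurable (by fun_prop))

lemma ae_nonneg_chiSquare (k : ℕ) : ∀ᵐ u ∂chiSquare k, 0 ≤ u := by
  rw [chiSquare, ae_map_iff (Measurable.aemeasurable (by fun_prop)) measurableSet_Ici]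
  exact Filter.Eventually.of_forall fun z => Finset.sum_nonneg fun i _ => sq_nonneg _

lemma integral_exp_mul_sq_gaussianReal {s : ℝ} (hs : s < 1 / 2) :
    ∫ z, Real.exp (s * z ^ 2) ∂gaussianReal 0 1 = (√(1 - 2 * s))⁻¹ := by
  rw [integral_gaussianReal_eq_integral_smul one_ne_zero]
  have h : ∀ z : ℝ, gaussianPDFReal 0 1 z • Real.exp (s * z ^ 2)
      = (√(2 * Real.pi))⁻¹ * Real.exp (-(1 / 2 - s) * z ^ 2) := by
    intro z
    simp only [gaussianPDFReal, NNReal.coe_one, smul_eq_mul, mul_one, sub_zero]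
    rw [mul_assoc, ← Real.exp_add]
    congr 2
    ring
  simp_rw [h]
  rw [integral_const_mul, integral_gaussian, ← Real.sqrt_inv, ← Real.sqrt_inv,
    ← Real.sqrt_mul (by positivity)]
  congr 1
  have : (1 - 2 * s) ≠ 0 := by linarith
  have : (1 / 2 - s) ≠ 0 := by linarith
  have := Real.pi_ne_zero
  field_simp

lemma integrable_exp_mul_sq_gaussianReal {s : ℝ} (hs : s < 1 / 2) :
    Integrable (fun z => Real.exp (s * z ^ 2)) (gaussianReal 0 1) := by
  -- A non-integrable function has integral 0 by convention, while the value just computed is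
  -- positive.
  refine not_imp_comm.1 integral_undef ?_
  rw [integral_exp_mul_sq_gaussianReal hs]
  have : 0 < 1 - 2 * s := by linarith
  positivity

lemma integral_exp_mul_chiSquare (k : ℕ) {s : ℝ} (hs : s < 1 / 2) :
    ∫ u, Real.exp (s * u) ∂chiSquare k = ((√(1 - 2 * s))⁻¹) ^ k := by
  rw [chiSquare, integral_map (Measurable.aemeasurable (by fun_prop))
    (Measurable.aestronglyMeasurable (by fun_prop))]
  simp_rw [Finset.mul_sum, Real.exp_sum]
  rw [integral_fintype_prod_eq_pow (fun z : ℝ => Real.exp (s * z ^ 2)),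
    integral_exp_mul_sq_gaussianReal hs, Fintype.card_fin]

lemma integrable_exp_mul_chiSquare (k : ℕ) {s : ℝ} (hs : s < 1 / 2) :
    Integrable (fun u => Real.exp (s * u)) (chiSquare k) := by
  refine not_imp_comm.1 integral_undef ?_
  rw [integral_exp_mul_chiSquare k hs]
  have : 0 < 1 - 2 * s := by linarith
  positivity

lemma integrable_sq_gaussianReal : Integrable (fun z : ℝ => z ^ 2) (gaussianReal 0 1) :=
  IsGaussian.memLp_two_id.integrable_sq

lemma integral_sq_gaussianReal : ∫ z : ℝ, z ^ 2 ∂gaussianReal 0 1 = 1 := by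
  have h := variance_fun_id_gaussianReal (μ := 0) (v := 1)
  rw [variance_eq_integral measurable_id'.aemeasurable] at h
  simpa using h

lemma integrable_eval_sq_pi {k : ℕ} (i : Fin k) :
    Integrable (fun z : Fin k → ℝ => z i ^ 2) (Measure.pi fun _ => gaussianReal 0 1) :=
  integrable_comp_eval (μ := fun _ : Fin k => gaussianReal 0 1) (i := i)
    (f := fun z : ℝ => z ^ 2) integrable_sq_gaussianReal

lemma integrable_chiSquare (k : ℕ) : Integrable (fun u : ℝ => u) (chiSquare k) := by
  rw [chiSquare, integrable_map_measure (Measurable.aestronglyMeasurable (by fun_prop))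
    (Measurable.aemeasurable (by fun_prop))]
  exact integrable_finsetSum _ fun i _ =>
    integrable_eval_sq_pi i

lemma integral_chiSquare (k : ℕ) : ∫ u, u ∂chiSquare k = k := by
  rw [chiSquare, integral_map (Measurable.aemeasurable (by fun_prop))
    (Measurable.aestronglyMeasurable (by fun_prop)), integral_finsetSum _ fun i _ =>
    integrable_eval_sq_pi i]
  have h : ∀ i : Fin k, ∫ z : Fin k → ℝ, z i ^ 2 ∂Measure.pi (fun _ => gaussianReal 0 1) = 1 :=
    fun i => (integral_comp_eval (μ := fun _ : Fin k => gaussianReal 0 1) (i := i) (f := fun z : ℝ => z ^ 2)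
      (Measurable.aestronglyMeasurable (by fun_prop))).trans integral_sq_gaussianReal
  simp [h]

/-! ### The expected excess and the equation defining the penalty -/

lemma integrable_max_sub_mul_chiSquare (k l : ℕ) (c : ℝ) :
    Integrable (fun z : ℝ × ℝ => max (z.1 - c * z.2) 0) ((chiSquare k).prod (chiSquare l)) :=
  (((integrable_chiSquare k).comp_fst _).sub (((integrable_chiSquare l).comp_snd _).const_mul c)).pos_part

/-- The positive part is 1-Lipschitz and V has a finite mean, so the excess is Lipschitz in `x`. -/
lemma continuous_chiExcess (n d : ℕ) : Continuous (chiExcess n d) := by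
  set c : ℝ := |((n : ℝ) - d)⁻¹| * (n - d - 1 : ℕ) with hc
  have hc0 : 0 ≤ c := by positivity
  refine (LipschitzWith.of_dist_le_mul (K := ⟨c, hc0⟩) fun x y => ?_).continuous
  rw [Real.dist_eq, Real.dist_eq, chiExcess, chiExcess, ← integral_sub
    (integrable_max_sub_mul_chiSquare _ _ _) (integrable_max_sub_mul_chiSquare _ _ _)]
  have h2 := ((integrable_chiSquare (n - d - 1)).comp_snd (chiSquare (d + 1)))
  have h2i : ∫ z : ℝ × ℝ, z.2 ∂((chiSquare (d + 1)).prod (chiSquare (n - d - 1)))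
      = (n - d - 1 : ℕ) := by
    rw [integral_fun_snd (fun u : ℝ => u)]
    simp [integral_chiSquare]
  calc _ ≤ ∫ z : ℝ × ℝ, (|((n : ℝ) - d)⁻¹| * |x - y|) * z.2
        ∂((chiSquare (d + 1)).prod (chiSquare (n - d - 1))) := by
        rw [← Real.norm_eq_abs]
        refine norm_integral_le_of_norm_le (h2.const_mul _) ?_
        have hae : ∀ᵐ z ∂((chiSquare (d + 1)).prod (chiSquare (n - d - 1))), 0 ≤ z.2 :=
          Measure.quasiMeasurePreserving_snd.ae (ae_nonneg_chiSquare (n - d - 1))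
        filter_upwards [hae] with z hz
        rw [Real.norm_eq_abs]
        refine (abs_max_sub_max_le_abs _ _ _).trans ?_
        rw [← abs_mul, ← abs_of_nonneg hz, ← abs_mul, abs_of_nonneg hz, abs_sub_comm]
        refine le_of_eq (congrArg _ ?_)
        rw [div_eq_mul_inv, div_eq_mul_inv]; ring
    _ = _ := by
        rw [integral_const_mul, h2i]
        change _ = c * _
        rw [hc]; ring

lemma chiExcess_zero (n d : ℕ) : chiExcess n d 0 = d + 1 := by
  have h : chiExcess n d 0
      = ∫ z : ℝ × ℝ, z.1 ∂((chiSquare (d + 1)).prod (chiSquare (n - d - 1))) := by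
    refine integral_congr_ae ?_
    have hae : ∀ᵐ z ∂((chiSquare (d + 1)).prod (chiSquare (n - d - 1))), 0 ≤ z.1 :=
      Measure.quasiMeasurePreserving_fst.ae (ae_nonneg_chiSquare (d + 1))
    filter_upwards [hae] with z hz
    simp [hz]
  rw [h, integral_fun_fst (fun u : ℝ => u)]
  simp [integral_chiSquare]

/-- Chernoff bound for the expected excess. -/
lemma chiExcess_le (n d : ℕ) {x : ℝ} (hd : d < n) (hx : 0 ≤ x) :
    chiExcess n d x
      ≤ 4 * √2 ^ (d + 1) * ((√(1 + x / (2 * ((n : ℝ) - d))))⁻¹) ^ (n - d - 1) := by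
  have hnd : (0 : ℝ) < n - d := by
    have : (d : ℝ) < n := by exact_mod_cast hd
    linarith
  set c : ℝ := x / ((n : ℝ) - d) with hc
  have hc0 : 0 ≤ c := by positivity
  -- The bound is u₊ ≤ 4 exp(u/4); any rate below 1/2 keeps the exponential moment of U finite.
  have h1 : (1 / 4 : ℝ) < 1 / 2 := by norm_num
  have h2 : -(c / 4) < 1 / 2 := by linarith
  calc chiExcess n d x
      ≤ ∫ z : ℝ × ℝ, 4 * (Real.exp (1 / 4 * z.1) * Real.exp (-(c / 4) * z.2))
        ∂((chiSquare (d + 1)).prod (chiSquare (n - d - 1))) := by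
        refine integral_mono (integrable_max_sub_mul_chiSquare _ _ _)
          (((integrable_exp_mul_chiSquare _ h1).mul_prod
            (integrable_exp_mul_chiSquare _ h2)).const_mul 4) fun z => ?_
        rw [← Real.exp_add]
        refine max_le ?_ (by positivity)
        have := Real.add_one_le_exp (1 / 4 * z.1 + -(c / 4) * z.2)
        linarith
    _ = 4 * √2 ^ (d + 1) * ((√(1 + x / (2 * ((n : ℝ) - d))))⁻¹) ^ (n - d - 1) := by
        rw [integral_const_mul, integral_prod_mul (fun u : ℝ => Real.exp (1 / 4 * u))
          (fun v : ℝ => Real.exp (-(c / 4) * v)),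
          integral_exp_mul_chiSquare _ h1, integral_exp_mul_chiSquare _ h2, mul_assoc]
        congr 3
        · rw [← Real.sqrt_inv]; norm_num
        · congr 3
          rw [hc]; field_simp; ring

/-- The intermediate value theorem on [0, x] produces a root, and `penDelta` is the infimum of the
roots; neither monotonicity nor uniqueness is needed. -/
lemma penDelta_le {n d : ℕ} {δ x : ℝ} (hδ : 0 ≤ δ) (hx : 0 ≤ x)
    (h : chiExcess n d x ≤ Real.exp (-δ)) : penDelta n d δ ≤ x := by
  have h0 : Real.exp (-δ) ≤ chiExcess n d 0 := by
    rw [chiExcess_zero]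
    have : Real.exp (-δ) ≤ 1 := Real.exp_le_one_iff.2 (by linarith)
    have : (0 : ℝ) ≤ d := d.cast_nonneg
    linarith
  obtain ⟨y, hy, hye⟩ := intermediate_value_Icc' hx (continuous_chiExcess n d).continuousOn
    (show Real.exp (-δ) ∈ Set.Icc (chiExcess n d x) (chiExcess n d 0) from ⟨h, h0⟩)
  exact (csInf_le (⟨0, fun z hz => hz.1⟩ : BddBelow {x : ℝ | 0 ≤ x ∧ chiExcess n d x = Real.exp (-δ)})
    ⟨hy.1, hye⟩).trans hy.2

lemma penDelta_nonneg (n d : ℕ) (δ : ℝ) : 0 ≤ penDelta n d δ :=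
  Real.sInf_nonneg fun _ hx => hx.1

/-- If `x` is so large that the Chernoff bound is at most `exp (-δ)`. -/
lemma chiExcess_le_exp_neg {n d : ℕ} {δ t : ℝ} (hd : d + 2 ≤ n) (ht : 0 ≤ t)
    (h : δ + (d + 1) / 2 * Real.log 2 + Real.log 4 ≤ ((n : ℝ) - d - 1) / 2 * t) :
    chiExcess n d (2 * ((n : ℝ) - d) * (Real.exp t - 1)) ≤ Real.exp (-δ) := by
  have hnd : (d : ℝ) + 2 ≤ n := by exact_mod_cast hd
  have he : 0 ≤ Real.exp t - 1 := by linarith [Real.add_one_le_exp t]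
  have hnd0 : (n : ℝ) - d ≠ 0 := by linarith
  refine (chiExcess_le n d (by omega) (mul_nonneg (by linarith) he)).trans ?_
  -- The point 2(n-d)(exp t - 1) is chosen so that the base of the Chernoff bound is exactly exp t.
  have h1 : 1 + 2 * ((n : ℝ) - d) * (Real.exp t - 1) / (2 * ((n : ℝ) - d)) = Real.exp t := by
    field_simp; ring
  have h2 : √2 = Real.exp (Real.log 2 / 2) := by
    rw [← Real.exp_log (show (0 : ℝ) < √2 by positivity), Real.log_sqrt (by norm_num)]
  have h3 : (√(Real.exp t))⁻¹ = Real.exp (-(t / 2)) := by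
    rw [Real.exp_neg, Real.exp_half]
  rw [h1, h2, h3, ← Real.exp_nat_mul, ← Real.exp_nat_mul]
  nth_rw 1 [← Real.exp_log (show (0 : ℝ) < 4 by norm_num)]
  rw [← Real.exp_add, ← Real.exp_add]
  refine Real.exp_le_exp.2 ?_
  have hcast : ((n - d - 1 : ℕ) : ℝ) = n - d - 1 := by
    rw [Nat.sub_sub, Nat.cast_sub (by omega)]; push_cast; ring
  rw [hcast]
  push_cast
  linarith

/-- A root exists because the Chernoff bound falls below exp(-δ) far out; the set of roots is
closed, so its infimum is one of them. -/
lemma chiExcess_penDelta {n d : ℕ} {δ : ℝ} (hd : d + 2 ≤ n) (hδ : 0 ≤ δ) :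
    chiExcess n d (penDelta n d δ) = Real.exp (-δ) := by
  have hnd : (d : ℝ) + 2 ≤ n := by exact_mod_cast hd
  have h0 : Real.exp (-δ) ≤ chiExcess n d 0 := by
    rw [chiExcess_zero]
    have : Real.exp (-δ) ≤ 1 := Real.exp_le_one_iff.2 (by linarith)
    have : (0 : ℝ) ≤ d := d.cast_nonneg
    linarith
  set t : ℝ := (δ + (d + 1) / 2 * Real.log 2 + Real.log 4) / (((n : ℝ) - d - 1) / 2) with ht
  have hN : 0 < ((n : ℝ) - d - 1) / 2 := by linarith
  have ht0 : 0 ≤ t := by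
    have := Real.log_nonneg (show (1 : ℝ) ≤ 2 by norm_num)
    have := Real.log_nonneg (show (1 : ℝ) ≤ 4 by norm_num)
    positivity
  have he : 0 ≤ Real.exp t - 1 := by linarith [Real.add_one_le_exp t]
  have hx : 0 ≤ 2 * ((n : ℝ) - d) * (Real.exp t - 1) := mul_nonneg (by linarith) he
  obtain ⟨y, hy, hye⟩ := intermediate_value_Icc' hx (continuous_chiExcess n d).continuousOn
    (show Real.exp (-δ) ∈ Set.Icc _ (chiExcess n d 0) from
      ⟨chiExcess_le_exp_neg hd ht0 (mul_div_cancel₀ _ hN.ne').ge, h0⟩)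
  have hcl : IsClosed {x : ℝ | 0 ≤ x ∧ chiExcess n d x = Real.exp (-δ)} :=
    isClosed_Ici.inter (isClosed_eq (continuous_chiExcess n d) continuous_const)
  exact (hcl.csInf_mem ⟨y, hy.1, hye⟩ ⟨0, fun z hz => hz.1⟩).2

/-! ### Cochran's theorem -/

lemma norm_sq_sum_smul_orthonormalBasis {ι V : Type*} [Fintype ι] [NormedAddCommGroup V]
    [InnerProductSpace ℝ V] (b : OrthonormalBasis ι ℝ V) (x : ι → ℝ) :
    ‖∑ i, x i • b i‖ ^ 2 = ∑ i, x i ^ 2 := by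
  rw [← real_inner_self_eq_norm_sq, b.orthonormal.inner_sum]
  simp [sq]

/-- Cochran's theorem for the squared norms of the projections onto a subspace and its
orthogonal complement. -/
lemma map_norm_sq_starProjection_stdGaussian {V : Type*} [NormedAddCommGroup V]
    [InnerProductSpace ℝ V] [FiniteDimensional ℝ V] [MeasurableSpace V] [BorelSpace V]
    (W : Submodule ℝ V) {k l : ℕ} (hk : Module.finrank ℝ W = k) (hl : Module.finrank ℝ Wᗮ = l) :
    (stdGaussian V).map (fun z => (‖W.starProjection z‖ ^ 2, ‖z - W.starProjection z‖ ^ 2))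
      = (chiSquare k).prod (chiSquare l) := by
  set bW : OrthonormalBasis (Fin k) ℝ W := (stdOrthonormalBasis ℝ W).reindex (finCongr hk)
  set bP : OrthonormalBasis (Fin l) ℝ Wᗮ := (stdOrthonormalBasis ℝ Wᗮ).reindex (finCongr hl)
  -- In an orthonormal basis adapted to W ⊕ Wᗮ, the two squared norms involve disjoint blocks of
  -- independent coordinates.
  set b := (bW.prod bP).map W.orthogonalDecomposition.symm with hb
  rw [stdGaussian_eq_map_pi_orthonormalBasis b, Measure.map_map (by fun_prop) (by fun_prop),
    chiSquare, chiSquare, Measure.map_prod_map _ _ (by fun_prop) (by fun_prop),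
    ← (measurePreserving_sumPiEquivProdPi
      (fun _ : Fin k ⊕ Fin l => gaussianReal 0 1)).map_eq,
    Measure.map_map (by fun_prop) (by fun_prop)]
  congr 1
  funext x
  have hsum : ∑ i, x i • b i = ((∑ i, x (.inl i) • bW i : W) : V)
      + ((∑ i, x (.inr i) • bP i : Wᗮ) : V) := by
    rw [Fintype.sum_sum_type]
    simp [hb]
  simp only [Function.comp_apply, Prod.map]
  rw [hsum, Submodule.eq_starProjection_of_mem_orthogonal' (SetLike.coe_mem _) (SetLike.coe_mem _) rfl,
    add_sub_cancel_left, Submodule.norm_coe, Submodule.norm_coe,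
    norm_sq_sum_smul_orthonormalBasis, norm_sq_sum_smul_orthonormalBasis]
  rfl

/-! ### Gaussian moments -/

section Moments

variable {n : ℕ}

lemma integrable_comp_eval_stdGaussian {g : ℝ → ℝ} (hg : Integrable g (gaussianReal 0 1))
    (i : Fin n) :
    Integrable (fun z => g (z i)) (stdGaussian (EuclideanSpace ℝ (Fin n))) := by
  have h : (stdGaussian (EuclideanSpace ℝ (Fin n))).map (fun z => z i) = gaussianReal 0 1 := by
    rw [← map_pi_eq_stdGaussian, Measure.map_map (by fun_prop) (by fun_prop)]
    exact (measurePreserving_eval (fun _ : Fin n => gaussianReal 0 1) i).map_eq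
  exact Integrable.comp_measurable (by rwa [h]) (by fun_prop)

lemma integral_comp_eval_stdGaussian {g : ℝ → ℝ} (hg : Integrable g (gaussianReal 0 1))
    (i : Fin n) :
    ∫ z, g (z i) ∂stdGaussian (EuclideanSpace ℝ (Fin n)) = ∫ u, g u ∂gaussianReal 0 1 := by
  have h : (stdGaussian (EuclideanSpace ℝ (Fin n))).map (fun z => z i) = gaussianReal 0 1 := by
    rw [← map_pi_eq_stdGaussian, Measure.map_map (by fun_prop) (by fun_prop)]
    exact (measurePreserving_eval (fun _ : Fin n => gaussianReal 0 1) i).map_eq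
  rw [← h, integral_map (by fun_prop) (by rw [h]; exact hg.aestronglyMeasurable)]

lemma integrable_norm_sq_stdGaussian (n : ℕ) :
    Integrable (fun z => ‖z‖ ^ 2) (stdGaussian (EuclideanSpace ℝ (Fin n))) := by
  simp_rw [EuclideanSpace.real_norm_sq_eq]
  exact integrable_finsetSum _ fun i _ =>
    integrable_comp_eval_stdGaussian (g := fun u => u ^ 2) integrable_sq_gaussianReal i

lemma integral_norm_sq_stdGaussian (n : ℕ) :
    ∫ z, ‖z‖ ^ 2 ∂stdGaussian (EuclideanSpace ℝ (Fin n)) = n := by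
  simp_rw [EuclideanSpace.real_norm_sq_eq]
  rw [integral_finsetSum _ fun i _ =>
    integrable_comp_eval_stdGaussian (g := fun u => u ^ 2) integrable_sq_gaussianReal i]
  have h : ∀ i : Fin n, ∫ z, z i ^ 2 ∂stdGaussian (EuclideanSpace ℝ (Fin n)) = 1 := fun i =>
    (integral_comp_eval_stdGaussian (g := fun u => u ^ 2) integrable_sq_gaussianReal i).trans
      integral_sq_gaussianReal
  simp [h]

lemma pow_four_le_exp (u : ℝ) : u ^ 4 ≤ 32 * Real.exp (1 / 4 * u ^ 2) := by
  have := Real.quadratic_le_exp_of_nonneg (show 0 ≤ 1 / 4 * u ^ 2 by positivity)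
  nlinarith [sq_nonneg u]

lemma integrable_pow_four_gaussianReal : Integrable (fun u : ℝ => u ^ 4) (gaussianReal 0 1) := by
  refine ((integrable_exp_mul_sq_gaussianReal (s := 1 / 4) (by norm_num)).const_mul 32).mono'
    (by fun_prop) (Filter.Eventually.of_forall fun u => ?_)
  rw [Real.norm_of_nonneg (by positivity)]
  exact pow_four_le_exp u

lemma integral_pow_four_gaussianReal_le : ∫ u : ℝ, u ^ 4 ∂gaussianReal 0 1 ≤ 49 := by
  refine (integral_mono integrable_pow_four_gaussianReal
    ((integrable_exp_mul_sq_gaussianReal (s := 1 / 4) (by norm_num)).const_mul 32)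
    pow_four_le_exp).trans ?_
  rw [integral_const_mul, integral_exp_mul_sq_gaussianReal (by norm_num), ← Real.sqrt_inv]
  -- The square 49 ≥ 32√2 makes the root of the fourth moment of the norm at most 7n.
  have : √((1 - 2 * (1 / 4 : ℝ))⁻¹) ≤ 49 / 32 := by
    rw [Real.sqrt_le_left (by norm_num)]
    norm_num
  linarith

lemma norm_pow_four_le (z : EuclideanSpace ℝ (Fin n)) : ‖z‖ ^ 4 ≤ n * ∑ i, z i ^ 4 := by
  have h := sq_sum_le_card_mul_sum_sq (s := Finset.univ) (f := fun i => z i ^ 2)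
  rw [← EuclideanSpace.real_norm_sq_eq] at h
  simpa [← pow_mul] using h

lemma integrable_sum_pow_four_stdGaussian (n : ℕ) :
    Integrable (fun z => (n : ℝ) * ∑ i, z i ^ 4) (stdGaussian (EuclideanSpace ℝ (Fin n))) :=
  (integrable_finsetSum _ fun i _ => integrable_comp_eval_stdGaussian (g := fun u => u ^ 4)
    integrable_pow_four_gaussianReal i).const_mul _

lemma integrable_norm_pow_four_stdGaussian (n : ℕ) :
    Integrable (fun z => ‖z‖ ^ 4) (stdGaussian (EuclideanSpace ℝ (Fin n))) := by
  refine (integrable_sum_pow_four_stdGaussian n).mono' (by fun_prop)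
    (Filter.Eventually.of_forall fun z => ?_)
  rw [Real.norm_of_nonneg (by positivity)]
  exact norm_pow_four_le z

lemma integral_norm_pow_four_stdGaussian_le (n : ℕ) :
    ∫ z, ‖z‖ ^ 4 ∂stdGaussian (EuclideanSpace ℝ (Fin n)) ≤ (7 * n) ^ 2 := by
  refine (integral_mono (integrable_norm_pow_four_stdGaussian n)
    (integrable_sum_pow_four_stdGaussian n) norm_pow_four_le).trans ?_
  rw [integral_const_mul, integral_finsetSum _ fun i _ => integrable_comp_eval_stdGaussian
    (g := fun u => u ^ 4) integrable_pow_four_gaussianReal i]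
  have h : ∀ i : Fin n, ∫ z, z i ^ 4 ∂stdGaussian (EuclideanSpace ℝ (Fin n)) ≤ 49 := fun i =>
    (integral_comp_eval_stdGaussian (g := fun u => u ^ 4) integrable_pow_four_gaussianReal i).trans_le
      integral_pow_four_gaussianReal_le
  have h' := Finset.sum_le_card_nsmul Finset.univ _ 49 fun i _ => h i
  rw [Finset.card_univ, Fintype.card_fin, nsmul_eq_mul] at h'
  nlinarith [n.cast_nonneg (α := ℝ)]

/-- Cauchy-Schwarz for the squared norm on an event. -/
lemma setIntegral_norm_sq_le {B : Set (EuclideanSpace ℝ (Fin n))} (hB : MeasurableSet B) :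
    ∫ z in B, ‖z‖ ^ 2 ∂stdGaussian (EuclideanSpace ℝ (Fin n))
      ≤ 7 * n * √((stdGaussian (EuclideanSpace ℝ (Fin n))).real B) := by
  set γ := stdGaussian (EuclideanSpace ℝ (Fin n)) with hγ
  have h2 : MemLp (fun z => ‖z‖ ^ 2) (ENNReal.ofReal 2) γ := by
    rw [show ENNReal.ofReal 2 = 2 by simp, memLp_two_iff_integrable_sq (by fun_prop)]
    simpa [← pow_mul] using integrable_norm_pow_four_stdGaussian n
  have hi : MemLp (B.indicator fun _ => (1 : ℝ)) (ENNReal.ofReal 2) γ :=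
    (memLp_const 1).indicator hB
  have h := integral_mul_le_Lp_mul_Lq_of_nonneg (μ := γ) Real.HolderConjugate.two_two
    (Filter.Eventually.of_forall fun z => by positivity)
    (Filter.Eventually.of_forall fun z => Set.indicator_nonneg (fun _ _ => zero_le_one) z) h2 hi
  have e1 : ∀ z : EuclideanSpace ℝ (Fin n), ‖z‖ ^ 2 * B.indicator (fun _ => (1 : ℝ)) z
      = B.indicator (fun z => ‖z‖ ^ 2) z := by
    intro z; by_cases hz : z ∈ B <;> simp [hz]
  have e2 : ∀ z : EuclideanSpace ℝ (Fin n), B.indicator (fun _ => (1 : ℝ)) z ^ 2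
      = B.indicator (fun _ => (1 : ℝ)) z := by
    intro z; by_cases hz : z ∈ B <;> simp [hz]
  simp only [Real.rpow_ofNat, ← Real.sqrt_eq_rpow, e1, e2] at h
  rw [integral_indicator hB, integral_indicator_const _ hB] at h
  refine h.trans ?_
  simp only [← pow_mul, smul_eq_mul, mul_one]
  refine mul_le_mul_of_nonneg_right ?_ (Real.sqrt_nonneg _)
  exact Real.sqrt_le_iff.2 ⟨by positivity, integral_norm_pow_four_stdGaussian_le n⟩

end Moments

/-- Writing the noise as σ times a standard Gaussian vector reduces everything to one reference law
and covers σ = 0. -/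
lemma hasLaw_observation {n : ℕ} {Ω : Type*} [MeasurableSpace Ω] {P : Measure Ω}
    [IsProbabilityMeasure P] {ε : Fin n → Ω → ℝ} {σ : ℝ≥0} (f : EuclideanSpace ℝ (Fin n))
    (hε : ∀ i, HasLaw (ε i) (gaussianReal 0 (σ ^ 2)) P) (hind : iIndepFun ε P) :
    HasLaw (observation f ε)
      ((stdGaussian (EuclideanSpace ℝ (Fin n))).map fun z => f + (σ : ℝ) • z) P := by
  have h1 : (Measure.pi fun _ : Fin n => gaussianReal 0 (σ ^ 2))
      = (Measure.pi fun _ : Fin n => gaussianReal 0 1).map fun x i => (σ : ℝ) * x i := by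
    rw [Measure.pi_map_pi (fun _ => by fun_prop)]
    congr
    funext i
    rw [gaussianReal_map_const_mul]
    congr 1
    · simp
    · ext; simp
  have h2 := hind.hasLaw_pi hε
  rw [h1] at h2
  refine ⟨?_, ?_⟩
  · exact Measurable.comp_aemeasurable
      (g := fun x : Fin n → ℝ => f + WithLp.toLp 2 x) (by fun_prop) h2.aemeasurable
  · change Measure.map ((fun x : Fin n → ℝ => f + WithLp.toLp 2 x) ∘ fun ω i => ε i ω) P = _
    rw [← AEMeasurable.map_map_of_aemeasurable (by fun_prop) h2.aemeasurable, h2.map_eq,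
      ← map_pi_eq_stdGaussian, Measure.map_map (by fun_prop) (by fun_prop),
      Measure.map_map (by fun_prop) (by fun_prop)]
    rfl

/-! ### Model spaces and their weights -/

section ModelSpaces

variable {n p : ℕ}

lemma finite_modelCollection (X : Matrix (Fin n) (Fin p) ℝ) (Dmax : ℕ) :
    (modelCollection X Dmax).Finite := by
  refine (Set.finite_range (modelSpace X)).subset ?_
  rintro S ⟨m, -, rfl⟩
  exact ⟨m, rfl⟩

lemma finrank_modelSpace_le_card (X : Matrix (Fin n) (Fin p) ℝ) (m : Finset (Fin p)) :
    Module.finrank ℝ (modelSpace X m) ≤ m.card := by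
  classical
  rw [modelSpace, ← Finset.coe_image]
  exact (finrank_span_finset_le_card _).trans Finset.card_image_le

/-- Extract a basis from the columns. Indexing spaces by such sets leaves at most `p.choose D` of
them in dimension D, as the weights require. -/
lemma exists_modelSpace_eq_card_eq_finrank (X : Matrix (Fin n) (Fin p) ℝ)
    (m : Finset (Fin p)) :
    ∃ m' : Finset (Fin p), modelSpace X m' = modelSpace X m ∧
      Module.finrank ℝ (modelSpace X m') = m'.card := by
  classical
  obtain ⟨b, hbm, -, hsub, hli⟩ := exists_linearIndepOn_extension
    (K := ℝ) (v := fun j : Fin p => (WithLp.toLp 2 (fun i : Fin n => X i j)))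
    (linearIndepOn_empty ℝ _) (Set.empty_subset (m : Set (Fin p)))
  refine ⟨b.toFinset, ?_, ?_⟩
  · rw [modelSpace, modelSpace, Set.coe_toFinset]
    exact le_antisymm (Submodule.span_mono (Set.image_mono hbm)) (Submodule.span_le.2 hsub)
  · rw [modelSpace, Set.coe_toFinset, ← Set.range_domRestrict]
    exact (finrank_span_eq_card hli).trans (Set.toFinset_card b).symm

lemma exp_neg_weight {S : Submodule ℝ (EuclideanSpace ℝ (Fin n))}
    (h : Module.finrank ℝ S ≤ p) :
    Real.exp (-weight p S)
      = ((p.choose (Module.finrank ℝ S) : ℝ) * (1 + Module.finrank ℝ S))⁻¹ := by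
  have h1 : (0 : ℝ) < p.choose (Module.finrank ℝ S) := by exact_mod_cast Nat.choose_pos h
  rw [weight, Real.exp_neg, Real.exp_add, Real.exp_log h1, Real.exp_log (by positivity)]

/-- One index set for each family of linearly independent columns. -/
lemma sum_exp_neg_weight_le (X : Matrix (Fin n) (Fin p) ℝ) :
    ∑ m : Finset (Fin p) with Module.finrank ℝ (modelSpace X m) = m.card,
      Real.exp (-weight p (modelSpace X m)) ≤ 1 + Real.log (p + 1) := by
  calc _ ≤ ∑ m : Finset (Fin p), ((p.choose m.card : ℝ) * (1 + m.card))⁻¹ := by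
        refine (Finset.sum_le_sum fun m hm => ?_).trans
          (Finset.sum_le_sum_of_subset_of_nonneg (Finset.filter_subset _ _)
            fun m _ _ => by positivity)
        rw [Finset.mem_filter] at hm
        rw [exp_neg_weight (hm.2.trans_le (card_finset_fin_le m)), hm.2]
    -- The number of index sets of size k cancels the binomial coefficient in the weight.
    _ = ∑ k ∈ Finset.range (p + 1), ((k : ℝ) + 1)⁻¹ := by
        rw [← Finset.powerset_univ,
          Finset.sum_powerset_apply_card (fun k => ((p.choose k : ℝ) * (1 + k))⁻¹)]
        rw [Finset.card_univ, Fintype.card_fin]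
        refine Finset.sum_congr rfl fun k hk => ?_
        have h1 : (p.choose k : ℝ) ≠ 0 := by
          exact_mod_cast (Nat.choose_pos (Nat.lt_succ_iff.1 (Finset.mem_range.1 hk))).ne'
        rw [nsmul_eq_mul, mul_inv, mul_inv_cancel_left₀ h1, add_comm]
    _ ≤ 1 + Real.log (p + 1) := by
        have h := harmonic_le_one_add_log (p + 1)
        rw [harmonic] at h
        push_cast at h
        exact h

end ModelSpaces

/-! ### Size of the penalty -/

lemma one_add_log_add_one_le {p : ℕ} (hp : 2 ≤ p) :
    1 + Real.log (p + 1) ≤ 4 * Real.log p := by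
  have hp' : (2 : ℝ) ≤ p := by exact_mod_cast hp
  have h1 : Real.log (p + 1) ≤ 2 * Real.log p := by
    rw [← Real.log_rpow (by linarith)]
    refine Real.log_le_log (by positivity) ?_
    norm_cast
    nlinarith
  have h2 := Real.log_le_log (by norm_num) hp'
  have := Real.log_two_gt_d9
  linarith

/-- Since log p > 0.693, n - M - 1 is at least 0.27 n - 1; it is also at least 1, and averaging the
two bounds gives n/8. -/
lemma sub_sub_one_ge {n p D M : ℕ} (hp : 2 ≤ p) (hD : D ≤ M) (hM : M + 2 ≤ n)
    (h : M * Real.log p ≤ (n : ℝ) / 2) : (n : ℝ) / 8 ≤ n - D - 1 := by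
  have h2 := Real.log_le_log (by norm_num) (show (2 : ℝ) ≤ p by exact_mod_cast hp)
  have h3 := Real.log_two_gt_d9
  have hM' : (M : ℝ) + 2 ≤ n := by exact_mod_cast hM
  have hD' : (D : ℝ) ≤ M := by exact_mod_cast hD
  have : (M : ℝ) * 0.693 ≤ M * Real.log p :=
    mul_le_mul_of_nonneg_left (by linarith) M.cast_nonneg
  linarith

/-- The penalty of a space of dimension `D ≤ M` is at most of order `M log p`. -/
lemma penDelta_div_le {n p D M : ℕ} (hp : 2 ≤ p) (hD : D ≤ M) (hDp : D ≤ p) (hM0 : 1 ≤ M)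
    (hM : M + 2 ≤ n) (h : M * Real.log p ≤ (n : ℝ) / 2) :
    penDelta n D (Real.log (p.choose D) + Real.log (1 + D)) / ((n : ℝ) - D)
      ≤ 192 * Real.exp 48 * (M * Real.log p) / n := by
  have hp' : (2 : ℝ) ≤ p := by exact_mod_cast hp
  have h2 := Real.log_le_log (by norm_num) hp'
  have h3 := Real.log_two_gt_d9
  have hM' : (M : ℝ) + 2 ≤ n := by exact_mod_cast hM
  have hD' : (D : ℝ) ≤ M := by exact_mod_cast hD
  have hM0' : (1 : ℝ) ≤ M := by exact_mod_cast hM0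
  have hD0 : (0 : ℝ) ≤ D := D.cast_nonneg
  have hN := sub_sub_one_ge hp hD hM h
  have hn : (0 : ℝ) < n := by linarith
  set l : ℝ := (M : ℝ) * Real.log p with hl
  have hl0 : 0 ≤ l := by positivity
  have hlM : (M : ℝ) * 0.693 ≤ l := mul_le_mul_of_nonneg_left (by linarith) (by linarith)
  have hl2 : Real.log 2 ≤ l := h2.trans (le_mul_of_one_le_left (by linarith) hM0')
  -- The terms of the Chernoff condition add up to at most 6l, and (n-D-1)/2 ≥ n/16, whence 96. As l
  -- ≤ n/2, t ≤ 48 and exp t - 1 ≤ t exp 48.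
  set t : ℝ := 96 * l / n with ht
  have ht0 : 0 ≤ t := by positivity
  have ht48 : t ≤ 48 := by rw [ht, div_le_iff₀ hn]; linarith
  have hA1 : Real.log (p.choose D) ≤ l := by
    have : Real.log (p.choose D) ≤ D * Real.log p := by
      rw [← Real.log_pow]
      refine Real.log_le_log (by exact_mod_cast Nat.choose_pos hDp) ?_
      exact_mod_cast Nat.choose_le_pow p D
    exact this.trans (mul_le_mul_of_nonneg_right hD' (by linarith))
  have hA2 : Real.log (1 + D) ≤ M := by
    have := Real.log_le_sub_one_of_pos (show (0 : ℝ) < 1 + D by linarith)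
    linarith
  have hA3 : ((D : ℝ) + 1) / 2 * Real.log 2 ≤ l :=
    (mul_le_mul_of_nonneg_right (show ((D : ℝ) + 1) / 2 ≤ M by linarith) (by linarith)).trans
      (mul_le_mul_of_nonneg_left h2 (by linarith))
  have hA4 : Real.log 4 = 2 * Real.log 2 := by
    rw [← Real.log_rpow (by norm_num)]; norm_num
  have hNt : 6 * l ≤ ((n : ℝ) - D - 1) / 2 * t := by
    have h6 : 6 * l = (n : ℝ) / 8 / 2 * t := by rw [ht]; field_simp; ring
    rw [h6]
    exact mul_le_mul_of_nonneg_right (by linarith) ht0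
  have hexp := chiExcess_le_exp_neg (n := n) (d := D)
    (δ := Real.log (p.choose D) + Real.log (1 + D)) (by omega) ht0 (by linarith)
  have he0 : 0 ≤ Real.exp t - 1 := by linarith [Real.add_one_le_exp t]
  have he : Real.exp t - 1 ≤ t * Real.exp 48 := by
    have h5 := Real.add_one_le_exp (-t)
    rw [Real.exp_neg, ← one_div, le_div_iff₀ (Real.exp_pos t)] at h5
    have h7 := mul_le_mul_of_nonneg_left (Real.exp_le_exp.2 ht48) ht0
    nlinarith
  have hpen := penDelta_le (add_nonneg (Real.log_natCast_nonneg _)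
    (Real.log_nonneg (by linarith))) (mul_nonneg (by linarith) he0) hexp
  rw [div_le_iff₀ (by linarith)]
  refine hpen.trans ?_
  have h8 : 192 * Real.exp 48 * l / n * ((n : ℝ) - D) = 2 * ((n : ℝ) - D) * (t * Real.exp 48) := by
    rw [ht]; ring
  rw [h8]
  exact mul_le_mul_of_nonneg_left he (by linarith)

/-! ### Geometry of projections -/

/-- Even when f ∈ T a dimension is added, so that the degrees of freedom are always those in the
definition of pen_Δ. -/
lemma exists_le_mem_finrank_eq_add_one {V : Type*} [AddCommGroup V] [Module ℝ V]
    [FiniteDimensional ℝ V] (T : Submodule ℝ V) (f : V)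
    (h : Module.finrank ℝ T < Module.finrank ℝ V) :
    ∃ W : Submodule ℝ V, T ≤ W ∧ f ∈ W ∧ Module.finrank ℝ W = Module.finrank ℝ T + 1 := by
  by_cases hf : f ∈ T
  · obtain ⟨v, -, hv⟩ := SetLike.exists_of_lt (Ne.lt_top (a := T) fun hT => by rw [hT, finrank_top] at h; exact h.false)
    exact ⟨_, le_sup_left, Submodule.mem_sup_left hf, Submodule.finrank_sup_span_singleton hv⟩
  · exact ⟨_, le_sup_left, Submodule.mem_sup_right (Submodule.mem_span_singleton_self f),
      Submodule.finrank_sup_span_singleton hf⟩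

section Projections

variable {V : Type*} [NormedAddCommGroup V] [InnerProductSpace ℝ V] [FiniteDimensional ℝ V]

lemma norm_sub_starProjection_le_norm_sub (T : Submodule ℝ V) (y : V) {w : V} (hw : w ∈ T) :
    ‖y - T.starProjection y‖ ≤ ‖y - w‖ := by
  rw [T.starProjection_minimal y]
  exact ciInf_le ⟨0, by rintro _ ⟨x, rfl⟩; exact norm_nonneg _⟩ (⟨w, hw⟩ : T)

lemma norm_sub_starProjection_le (T : Submodule ℝ V) (y : V) :
    ‖y - T.starProjection y‖ ≤ ‖y‖ := by
  simpa using norm_sub_starProjection_le_norm_sub T y T.zero_mem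

lemma add_sub_starProjection_of_mem {W : Submodule ℝ V} {f : V} (hf : f ∈ W) (e : V) :
    f + e - W.starProjection (f + e) = e - W.starProjection e := by
  rw [map_add, Submodule.starProjection_eq_self_iff.2 hf]
  abel

/-- As f - h ∈ W, its inner product with e only involves Π_W e; then expand ‖(f - h) + K Π_W e‖² ≥
0. -/
lemma mul_norm_sub_sq_le {W : Submodule ℝ V} {f e h : V} (hf : f ∈ W) (hh : h ∈ W) {K : ℝ}
    (hK : 0 < K) :
    (1 - K⁻¹) * ‖f - h‖ ^ 2 ≤ ‖f + e - h‖ ^ 2 - ‖e‖ ^ 2 + K * ‖W.starProjection e‖ ^ 2 := by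
  have h1 : ‖f + e - h‖ ^ 2 = ‖f - h‖ ^ 2 + 2 * inner ℝ (f - h) e + ‖e‖ ^ 2 := by
    rw [← norm_add_sq_real]
    congr 2
    abel
  have h2 : inner ℝ (f - h) e = inner ℝ (f - h) (W.starProjection e) := by
    rw [← Submodule.inner_starProjection_left_eq_right,
      Submodule.starProjection_eq_self_iff.2 (W.sub_mem hf hh)]
  have h3 : 0 ≤ K⁻¹ * ‖(f - h) + K • W.starProjection e‖ ^ 2 := by positivity
  rw [norm_add_sq_real, inner_smul_right, norm_smul, Real.norm_of_nonneg hK.le] at h3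
  have h4 : K⁻¹ * (‖f - h‖ ^ 2 + 2 * (K * inner ℝ (f - h) (W.starProjection e))
      + (K * ‖W.starProjection e‖) ^ 2)
      = K⁻¹ * ‖f - h‖ ^ 2 + 2 * inner ℝ (f - h) (W.starProjection e)
        + K * ‖W.starProjection e‖ ^ 2 := by
    field_simp
  rw [h4] at h3
  rw [h1, h2]
  linarith

end Projections

/-! ### Deterministic consequences of minimizing the criterion -/

section Criterion

variable {n p : ℕ}

lemma crit_le {K α : ℝ} {T : Set (Submodule ℝ (EuclideanSpace ℝ (Fin n)))} (hT : T.Finite)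
    {S : Submodule ℝ (EuclideanSpace ℝ (Fin n))} (hS : S ∈ T) (y g : EuclideanSpace ℝ (Fin n)) :
    crit K α p T y g ≤ ‖y - S.starProjection g‖ ^ 2 + α * ‖g - S.starProjection g‖ ^ 2
      + penalty K p S * varEst S y := by
  have := hT.to_subtype
  exact ciInf_le (Set.finite_range _).bddBelow (⟨S, hS⟩ : T)

lemma exists_crit_eq (K α : ℝ) {T : Set (Submodule ℝ (EuclideanSpace ℝ (Fin n)))}
    (hT : T.Finite) (hT' : T.Nonempty) (y g : EuclideanSpace ℝ (Fin n)) :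
    ∃ S ∈ T, ‖y - S.starProjection g‖ ^ 2 + α * ‖g - S.starProjection g‖ ^ 2
      + penalty K p S * varEst S y = crit K α p T y g := by
  have := hT.to_subtype
  have := hT'.to_subtype
  obtain ⟨S, hS⟩ := exists_eq_ciInf_of_finite (f := fun S : T =>
    ‖y - S.1.starProjection g‖ ^ 2 + α * ‖g - S.1.starProjection g‖ ^ 2
      + penalty K p S.1 * varEst S.1 y)
  exact ⟨S.1, S.2, hS⟩

lemma crit_projEst_le {K α : ℝ} {T : Set (Submodule ℝ (EuclideanSpace ℝ (Fin n)))}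
    (hT : T.Finite) {X : Matrix (Fin n) (Fin p) ℝ} {m : Finset (Fin p)}
    (hm : modelSpace X m ∈ T) (y : EuclideanSpace ℝ (Fin n)) :
    crit K α p T y (projEst X m y) ≤ ‖y - (modelSpace X m).starProjection y‖ ^ 2
      + penalty K p (modelSpace X m) * varEst (modelSpace X m) y := by
  refine (crit_le hT hm y _).trans_eq ?_
  have h : (modelSpace X m).starProjection (projEst X m y) = projEst X m y :=
    Submodule.starProjection_eq_self_iff.2 (Submodule.starProjection_apply_mem _ _)
  rw [h, sub_self, norm_zero, projEst]
  ring

/-- The part of the noise `z` that is not compensated by the penalty of a space of dimension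
`d`, in a space `W` of dimension `d + 1`. -/
noncomputable def noiseExcess (p d : ℕ) (W : Submodule ℝ (EuclideanSpace ℝ (Fin n)))
    (z : EuclideanSpace ℝ (Fin n)) : ℝ :=
  max (‖W.starProjection z‖ ^ 2
    - penDelta n d (Real.log (p.choose d) + Real.log (1 + d)) / ((n : ℝ) - d)
      * ‖z - W.starProjection z‖ ^ 2) 0

lemma noiseExcess_nonneg (p d : ℕ) (W : Submodule ℝ (EuclideanSpace ℝ (Fin n)))
    (z : EuclideanSpace ℝ (Fin n)) : 0 ≤ noiseExcess p d W z :=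
  le_max_right _ _

lemma noiseExcess_smul (p d : ℕ) (W : Submodule ℝ (EuclideanSpace ℝ (Fin n))) (c : ℝ)
    (z : EuclideanSpace ℝ (Fin n)) :
    noiseExcess p d W (c • z) = c ^ 2 * noiseExcess p d W z := by
  rw [noiseExcess, noiseExcess, mul_max_of_nonneg _ _ (sq_nonneg c), mul_zero, map_smul,
    ← smul_sub, norm_smul, norm_smul, mul_pow, mul_pow, Real.norm_eq_abs, sq_abs]
  ring_nf

/-- The risk bound for a space `T` that does at least as well as `S` for the penalized
criterion. -/
lemma mul_norm_sub_sq_add_le {K α : ℝ} (hK : 1 < K)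
    {S T W : Submodule ℝ (EuclideanSpace ℝ (Fin n))} {f e g : EuclideanSpace ℝ (Fin n)}
    (hfS : f ∈ S) (hSn : Module.finrank ℝ S < n) (hTW : T ≤ W) (hfW : f ∈ W)
    (hTn : Module.finrank ℝ T < n)
    (h : ‖f + e - T.starProjection g‖ ^ 2 + α * ‖g - T.starProjection g‖ ^ 2
        + penalty K p T * varEst T (f + e)
      ≤ ‖f + e - S.starProjection (f + e)‖ ^ 2 + penalty K p S * varEst S (f + e)) :
    (1 - K⁻¹) * ‖f - T.starProjection g‖ ^ 2 + α * ‖g - T.starProjection g‖ ^ 2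
      ≤ K * (noiseExcess p (Module.finrank ℝ T) W e
        + penDelta n (Module.finrank ℝ S) (weight p S) / ((n : ℝ) - Module.finrank ℝ S)
          * ‖e‖ ^ 2) := by
  have hK0 : 0 < K := by linarith
  have hTn' : (0 : ℝ) < n - Module.finrank ℝ T := sub_pos.2 (by exact_mod_cast hTn)
  have hSn' : (0 : ℝ) < n - Module.finrank ℝ S := sub_pos.2 (by exact_mod_cast hSn)
  have h1 := mul_norm_sub_sq_le (e := e) hfW
    (hTW (Submodule.starProjection_apply_mem T g)) hK0
  have hS : ‖f + e - S.starProjection (f + e)‖ ^ 2 ≤ ‖e‖ ^ 2 := by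
    rw [add_sub_starProjection_of_mem hfS]
    exact pow_le_pow_left₀ (norm_nonneg _) (norm_sub_starProjection_le S e) 2
  -- Enlarging T to W shrinks the residual and eliminates f, leaving the component of e orthogonal
  -- to W.
  have hW : ‖e - W.starProjection e‖ ^ 2 ≤ ‖f + e - T.starProjection (f + e)‖ ^ 2 := by
    rw [← add_sub_starProjection_of_mem hfW]
    exact pow_le_pow_left₀ (norm_nonneg _) (norm_sub_starProjection_le_norm_sub W _
      (hTW (Submodule.starProjection_apply_mem T _))) 2
  have h2 : penalty K p S * varEst S (f + e)
      ≤ K * (penDelta n (Module.finrank ℝ S) (weight p S) / ((n : ℝ) - Module.finrank ℝ S)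
          * ‖e‖ ^ 2) := by
    rw [penalty, varEst, mul_assoc, div_mul_eq_mul_div, mul_div_assoc]
    have := penDelta_nonneg n (Module.finrank ℝ S) (weight p S)
    gcongr
  have h3 : K * (penDelta n (Module.finrank ℝ T) (weight p T) / ((n : ℝ) - Module.finrank ℝ T)
          * ‖e - W.starProjection e‖ ^ 2) ≤ penalty K p T * varEst T (f + e) := by
    rw [penalty, varEst, mul_assoc, div_mul_eq_mul_div, mul_div_assoc]
    have := penDelta_nonneg n (Module.finrank ℝ T) (weight p T)
    gcongr
  have h4 : K * (‖W.starProjection e‖ ^ 2 - penDelta n (Module.finrank ℝ T) (weight p T)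
      / ((n : ℝ) - Module.finrank ℝ T) * ‖e - W.starProjection e‖ ^ 2)
      ≤ K * noiseExcess p (Module.finrank ℝ T) W e :=
    mul_le_mul_of_nonneg_left (le_max_left _ _) hK0.le
  linarith

/-- If the approximation spaces are spanned by selected predictors, the space that attains the
criterion of a minimizer contains the selected estimator. -/
lemma starProjection_projEst_eq_self {Λ : Type*} {K α : ℝ} (hα : 0 < α)
    {X : Matrix (Fin n) (Fin p) ℝ} {mhat : Λ → Finset (Fin p)}
    {SS : Λ → Set (Submodule ℝ (EuclideanSpace ℝ (Fin n)))} (hfin : ∀ lam, (SS lam).Finite)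
    (hmem : ∀ lam, modelSpace X (mhat lam) ∈ SS lam) {y : EuclideanSpace ℝ (Fin n)} {lam₀ : Λ}
    (hmin : ∀ lam, crit K α p (SS lam₀) y (projEst X (mhat lam₀) y)
      ≤ crit K α p (SS lam) y (projEst X (mhat lam) y))
    {T : Submodule ℝ (EuclideanSpace ℝ (Fin n))}
    (hT : T ∈ Set.range fun lam => modelSpace X (mhat lam))
    (hcrit : ‖y - T.starProjection (projEst X (mhat lam₀) y)‖ ^ 2
      + α * ‖projEst X (mhat lam₀) y - T.starProjection (projEst X (mhat lam₀) y)‖ ^ 2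
      + penalty K p T * varEst T y = crit K α p (SS lam₀) y (projEst X (mhat lam₀) y)) :
    T.starProjection (projEst X (mhat lam₀) y) = projEst X (mhat lam₀) y := by
  obtain ⟨lam, rfl⟩ := hT
  set g := projEst X (mhat lam₀) y
  -- Compare with the index that selected T: the penalties cancel and Π_T y is the point of T
  -- closest to y, so the α term has no room.
  have h1 := (hmin lam).trans (crit_projEst_le (hfin lam) (hmem lam) y)
  have h2 : ‖y - (modelSpace X (mhat lam)).starProjection y‖ ^ 2
      ≤ ‖y - (modelSpace X (mhat lam)).starProjection g‖ ^ 2 :=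
    pow_le_pow_left₀ (norm_nonneg _) (norm_sub_starProjection_le_norm_sub _ _
      (Submodule.starProjection_apply_mem _ _)) 2
  have h3 : α * ‖g - (modelSpace X (mhat lam)).starProjection g‖ ^ 2 ≤ 0 := by
    simp only at hcrit
    linarith
  have h4 : ‖g - (modelSpace X (mhat lam)).starProjection g‖ ^ 2 = 0 :=
    le_antisymm (nonpos_of_mul_nonpos_right h3 hα) (sq_nonneg _)
  rw [sq_eq_zero_iff, norm_eq_zero, sub_eq_zero] at h4
  exact h4.symm

/-- Pythagoras: the loss splits into ‖f - Πf‖² + ‖Πe‖². Being pointwise for every m, the bound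
survives data-dependent selection. -/
lemma norm_sub_projEst_sq_le (X : Matrix (Fin n) (Fin p) ℝ) (m : Finset (Fin p))
    (f e : EuclideanSpace ℝ (Fin n)) :
    ‖f - projEst X m (f + e)‖ ^ 2 ≤ ‖f‖ ^ 2 + ‖e‖ ^ 2 := by
  set S := modelSpace X m
  have h1 := S.norm_sq_eq_add_norm_sq_starProjection (f - S.starProjection (f + e))
  have h2 : S.starProjection (f - S.starProjection (f + e)) = -S.starProjection e := by
    rw [map_sub, Submodule.starProjection_eq_self_iff.2 (Submodule.starProjection_apply_mem S _),
      map_add]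
    abel
  have h3 : Sᗮ.starProjection (f - S.starProjection (f + e)) = f - S.starProjection f := by
    rw [Submodule.starProjection_orthogonal_val, h2, map_add]
    abel
  rw [h2, h3, norm_neg] at h1
  rw [projEst, h1, add_comm]
  exact add_le_add
    (pow_le_pow_left₀ (norm_nonneg _) (norm_sub_starProjection_le S f) 2)
    (pow_le_pow_left₀ (norm_nonneg _) (S.norm_starProjection_apply_le e) 2)

end Criterion

/-! ### Integration of the risk bounds -/

section Risk

variable {n p : ℕ}

lemma continuous_noiseExcess (p d : ℕ) (W : Submodule ℝ (EuclideanSpace ℝ (Fin n))) :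
    Continuous (noiseExcess p d W) := by
  unfold noiseExcess
  fun_prop

lemma integrable_noiseExcess (p d : ℕ) (W : Submodule ℝ (EuclideanSpace ℝ (Fin n)))
    (hd : d < n) : Integrable (noiseExcess p d W) (stdGaussian (EuclideanSpace ℝ (Fin n))) := by
  have hd' : (0 : ℝ) < n - d := sub_pos.2 (by exact_mod_cast hd)
  refine (integrable_norm_sq_stdGaussian n).mono'
    (continuous_noiseExcess p d W).aestronglyMeasurable (Filter.Eventually.of_forall fun z => ?_)
  rw [Real.norm_of_nonneg (noiseExcess_nonneg p d W z)]
  have h1 := pow_le_pow_left₀ (norm_nonneg _) (W.norm_starProjection_apply_le z) 2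
  have h2 := penDelta_nonneg n d (Real.log (p.choose d) + Real.log (1 + d))
  have h3 : 0 ≤ penDelta n d (Real.log (p.choose d) + Real.log (1 + d)) / ((n : ℝ) - d)
      * ‖z - W.starProjection z‖ ^ 2 := by positivity
  exact max_le (by linarith) (sq_nonneg _)

/-- The calibration of the penalty enters here: Cochran's theorem identifies the mean with the
excess at `penDelta`. -/
lemma integral_noiseExcess {d : ℕ} {W : Submodule ℝ (EuclideanSpace ℝ (Fin n))} (hd : d + 2 ≤ n)
    (hW : Module.finrank ℝ W = d + 1) :
    ∫ z, noiseExcess p d W z ∂stdGaussian (EuclideanSpace ℝ (Fin n))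
      = Real.exp (-(Real.log (p.choose d) + Real.log (1 + d))) := by
  have hW' : Module.finrank ℝ Wᗮ = n - d - 1 := by
    have := W.finrank_add_finrank_orthogonal
    rw [finrank_euclideanSpace_fin] at this
    omega
  have h0 : 0 ≤ Real.log (p.choose d) + Real.log (1 + d) :=
    add_nonneg (Real.log_natCast_nonneg _)
      (Real.log_nonneg (le_add_of_nonneg_right (Nat.cast_nonneg _)))
  rw [← chiExcess_penDelta hd h0, chiExcess, ← map_norm_sq_starProjection_stdGaussian W hW hW',
    integral_map (by fun_prop) (Continuous.aestronglyMeasurable (by fun_prop))]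
  rfl

/-- Integrated form of a risk bound that holds outside of the event `B`. -/
lemma integrable_and_integral_le_of_bound {ι : Type*} (I : Finset ι)
    (E : ι → EuclideanSpace ℝ (Fin n) → ℝ)
    (hEi : ∀ i ∈ I, Integrable (E i) (stdGaussian (EuclideanSpace ℝ (Fin n))))
    (hE0 : ∀ i ∈ I, ∀ z, 0 ≤ E i z) {r : EuclideanSpace ℝ (Fin n) → ℝ} (hr : Measurable r)
    (hr0 : ∀ z, 0 ≤ r z) {B : Set (EuclideanSpace ℝ (Fin n))} (hB : MeasurableSet B)
    {a b c s : ℝ} (ha : 0 ≤ a) (hb : 0 ≤ b) (hc : 0 ≤ c)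
    (hall : ∀ z, r z ≤ a + s ^ 2 * ‖z‖ ^ 2)
    (hgood : ∀ z, z ∉ B → r z ≤ c * (s ^ 2 * ∑ i ∈ I, E i z + b * (s ^ 2 * ‖z‖ ^ 2))) :
    Integrable r (stdGaussian (EuclideanSpace ℝ (Fin n))) ∧
    ∫ z, r z ∂stdGaussian (EuclideanSpace ℝ (Fin n))
      ≤ c * (s ^ 2 * ∑ i ∈ I, ∫ z, E i z ∂stdGaussian (EuclideanSpace ℝ (Fin n))
          + b * (s ^ 2 * n))
        + 7 * (a + n * s ^ 2) * √((stdGaussian (EuclideanSpace ℝ (Fin n))).real B) := by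
  set γ := stdGaussian (EuclideanSpace ℝ (Fin n)) with hγ
  have hN := integrable_norm_sq_stdGaussian n
  have hNi := integral_norm_sq_stdGaussian n
  rw [← hγ] at hN hNi
  have hri : Integrable r γ := by
    refine ((integrable_const a).add (hN.const_mul (s ^ 2))).mono' hr.aestronglyMeasurable
      (Filter.Eventually.of_forall fun z => ?_)
    rw [Real.norm_of_nonneg (hr0 z)]
    exact hall z
  refine ⟨hri, ?_⟩
  have hG : Integrable (fun z => c * (s ^ 2 * ∑ i ∈ I, E i z + b * (s ^ 2 * ‖z‖ ^ 2))) γ :=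
    (((integrable_finsetSum I hEi).const_mul _).add ((hN.const_mul _).const_mul _)).const_mul _
  have hA : Integrable (fun z => a + s ^ 2 * ‖z‖ ^ 2) γ :=
    (integrable_const a).add (hN.const_mul (s ^ 2))
  have hA' : Integrable (B.indicator fun z => a + s ^ 2 * ‖z‖ ^ 2) γ := hA.indicator hB
  have hpt : ∀ z, r z ≤ c * (s ^ 2 * ∑ i ∈ I, E i z + b * (s ^ 2 * ‖z‖ ^ 2))
      + B.indicator (fun z => a + s ^ 2 * ‖z‖ ^ 2) z := by
    intro z
    by_cases hz : z ∈ B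
    · rw [Set.indicator_of_mem hz]
      have := Finset.sum_nonneg fun i hi => hE0 i hi z
      have : 0 ≤ c * (s ^ 2 * ∑ i ∈ I, E i z + b * (s ^ 2 * ‖z‖ ^ 2)) := by positivity
      linarith [hall z]
    · rw [Set.indicator_of_notMem hz, add_zero]
      exact hgood z hz
  refine (integral_mono hri (hG.add hA') hpt).trans ?_
  simp only [Pi.add_apply]
  rw [integral_add hG hA', integral_const_mul,
    integral_add ((integrable_finsetSum I hEi).const_mul _) ((hN.const_mul _).const_mul _),
    integral_const_mul, integral_const_mul, integral_const_mul, integral_finsetSum I hEi, hNi,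
    integral_indicator hB, integral_add (integrable_const a).integrableOn
      (hN.const_mul (s ^ 2)).integrableOn, integral_const_mul, setIntegral_const]
  have h1 := setIntegral_norm_sq_le hB
  rw [← hγ] at h1
  -- A probability is at most its square root, so the constant part `a` joins the Cauchy-Schwarz
  -- term.
  have h2 : γ.real B ≤ √(γ.real B) := by
    refine Real.le_sqrt_of_sq_le ?_
    rw [sq]
    exact mul_le_of_le_one_left measureReal_nonneg measureReal_le_one
  have h3 := mul_le_mul_of_nonneg_left h1 (sq_nonneg s)
  have h4 := mul_le_mul_of_nonneg_right h2 ha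
  have h5 := mul_nonneg ha (Real.sqrt_nonneg (γ.real B))
  rw [smul_eq_mul]
  linarith

lemma measurable_comp_of_measurableSet_eq {V W ι : Type*} [MeasurableSpace V] [MeasurableSpace W]
    [Finite ι] {M : V → ι} (hM : ∀ i, MeasurableSet {y | M y = i}) {g : ι → V → W}
    (hg : ∀ i, Measurable (g i)) : Measurable fun y => g (M y) y := by
  intro s hs
  have : (fun y => g (M y) y) ⁻¹' s = ⋃ i, {y | M y = i} ∩ g i ⁻¹' s := by
    ext y
    simp
  rw [this]
  exact MeasurableSet.iUnion fun i => (hM i).inter (hg i hs)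

/-- The factor of the oracle bound for selection procedures whose risk is at most `c` times the
residual of the comparison of the criteria. -/
noncomputable def oracleConst (K c : ℝ) : ℝ := (c * K * (4 + 192 * Real.exp 48) + 7)⁻¹

lemma oracleConst_pos {K c : ℝ} (hK : 0 ≤ K) (hc : 0 ≤ c) : 0 < oracleConst K c := by
  unfold oracleConst
  positivity

/-- The oracle bound for a selected set of predictors `M`, under the standard Gaussian law. -/
lemma oracle_bound_stdGaussian {K c : ℝ} (hK : 1 < K) (hc : 0 ≤ c) {Dmax : ℕ} (hp : 2 ≤ p)
    (hDn : Dmax + 2 ≤ n) (hDp : Dmax * Real.log p ≤ (n : ℝ) / 2)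
    {X : Matrix (Fin n) (Fin p) ℝ} {f : EuclideanSpace ℝ (Fin n)} {s : ℝ}
    {M : EuclideanSpace ℝ (Fin n) → Finset (Fin p)}
    (hM : ∀ m, MeasurableSet {y | M y = m}) {mstar : Finset (Fin p)} (hne : mstar.Nonempty)
    (hcard : mstar.card ≤ Dmax) {B : Set (EuclideanSpace ℝ (Fin n))} (hB : MeasurableSet B)
    (hgood : ∀ y, y ∉ B → ∀ e, y = f + e → ∃ T ∈ modelCollection X Dmax,
      ∀ W : Submodule ℝ (EuclideanSpace ℝ (Fin n)), T ≤ W → f ∈ W →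
        ‖f - projEst X (M y) y‖ ^ 2 ≤ c * (K * (noiseExcess p (Module.finrank ℝ T) W e
          + penDelta n (Module.finrank ℝ (modelSpace X mstar)) (weight p (modelSpace X mstar))
            / ((n : ℝ) - Module.finrank ℝ (modelSpace X mstar)) * ‖e‖ ^ 2))) :
    Integrable (fun y => ‖f - projEst X (M y) y‖ ^ 2)
      ((stdGaussian (EuclideanSpace ℝ (Fin n))).map fun z => f + s • z) ∧
    oracleConst K c * ∫ y, ‖f - projEst X (M y) y‖ ^ 2
        ∂((stdGaussian (EuclideanSpace ℝ (Fin n))).map fun z => f + s • z)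
      ≤ Real.log p * mstar.card * s ^ 2 + (‖f‖ ^ 2 + n * s ^ 2)
        * √(((stdGaussian (EuclideanSpace ℝ (Fin n))).map fun z => f + s • z).real B) := by
  have hK0 : 0 < K := by linarith
  have hrm : Measurable fun y => ‖f - projEst X (M y) y‖ ^ 2 :=
    measurable_comp_of_measurableSet_eq hM (g := fun m y => ‖f - projEst X m y‖ ^ 2)
      fun m => by unfold projEst; fun_prop
  have hφ : Measurable fun z : EuclideanSpace ℝ (Fin n) => f + s • z := by fun_prop
  set S := modelSpace X mstar with hS
  have hSc : Module.finrank ℝ S ≤ mstar.card := finrank_modelSpace_le_card X mstar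
  have hlog : 0 ≤ Real.log p := Real.log_natCast_nonneg p
  have hcardp : (mstar.card : ℝ) * Real.log p ≤ n / 2 :=
    (mul_le_mul_of_nonneg_right (by exact_mod_cast hcard) hlog).trans hDp
  have hn : (0 : ℝ) < n := by exact_mod_cast (by omega : 0 < n)
  set b : ℝ := penDelta n (Module.finrank ℝ S) (weight p S) / ((n : ℝ) - Module.finrank ℝ S)
    with hb
  have hb0 : 0 ≤ b := div_nonneg (penDelta_nonneg _ _ _)
    (sub_nonneg.2 (by exact_mod_cast (by omega : Module.finrank ℝ S ≤ n)))
  -- Applied with M = |m*| rather than `Dmax`, so that the bound scales with the true model.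
  have hb1 : b ≤ 192 * Real.exp 48 * (mstar.card * Real.log p) / n :=
    penDelta_div_le hp hSc (hSc.trans (card_finset_fin_le mstar)) hne.card_pos (by omega) hcardp
  set I : Finset (Finset (Fin p)) :=
    {m | Module.finrank ℝ (modelSpace X m) = m.card ∧ m.card ≤ Dmax} with hI
  -- W depends on m and f but not on the noise, so Cochran's theorem applies to it; outside I the
  -- value ⊥ is a dummy.
  have hW : ∀ m, ∃ W : Submodule ℝ (EuclideanSpace ℝ (Fin n)), m ∈ I →
      modelSpace X m ≤ W ∧ f ∈ W ∧
        Module.finrank ℝ W = Module.finrank ℝ (modelSpace X m) + 1 := by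
    intro m
    by_cases hm : m ∈ I
    · obtain ⟨h1, h2⟩ := (Finset.mem_filter.1 hm).2
      obtain ⟨W, hW⟩ := exists_le_mem_finrank_eq_add_one (modelSpace X m) f
        (by rw [finrank_euclideanSpace_fin]; omega)
      exact ⟨W, fun _ => hW⟩
    · exact ⟨⊥, fun h => absurd h hm⟩
  choose W hW using hW
  have hdim : ∀ m ∈ I, Module.finrank ℝ (modelSpace X m) + 2 ≤ n := fun m hm => by
    obtain ⟨h1, h2⟩ := (Finset.mem_filter.1 hm).2
    omega
  obtain ⟨hint, hle⟩ := integrable_and_integral_le_of_bound I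
    (fun m => noiseExcess p (Module.finrank ℝ (modelSpace X m)) (W m))
    (fun m hm => integrable_noiseExcess _ _ _ (by have := hdim m hm; omega))
    (fun m _ => noiseExcess_nonneg _ _ _) (hrm.comp hφ) (fun z => sq_nonneg _) (hφ hB)
    (a := ‖f‖ ^ 2) (b := b) (c := c * K) (s := s) (sq_nonneg _) hb0 (by positivity)
    (fun z => by
      refine (norm_sub_projEst_sq_le X _ f (s • z)).trans_eq ?_
      rw [norm_smul, mul_pow, Real.norm_eq_abs, sq_abs])
    (fun z hz => by
      obtain ⟨T, ⟨m₀, hm₀, rfl⟩, hT⟩ := hgood _ hz (s • z) rfl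
      obtain ⟨m, hm, hmc⟩ := exists_modelSpace_eq_card_eq_finrank X m₀
      rw [← hm] at hT
      have hmI : m ∈ I := by
        refine Finset.mem_filter.2 ⟨Finset.mem_univ _, hmc, ?_⟩
        rw [← hmc, hm]
        exact (finrank_modelSpace_le_card X m₀).trans hm₀
      obtain ⟨hW1, hW2, -⟩ := hW m hmI
      refine (hT (W m) hW1 hW2).trans ?_
      rw [← mul_assoc, noiseExcess_smul, norm_smul, mul_pow, Real.norm_eq_abs, sq_abs]
      -- The excess of the noise-dependent T is one of the nonnegative terms of a deterministic sum,
      -- so T need not be chosen measurably.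
      have := Finset.single_le_sum (f := fun m =>
        noiseExcess p (Module.finrank ℝ (modelSpace X m)) (W m) z)
        (fun m _ => noiseExcess_nonneg _ _ _ _) hmI
      gcongr)
  refine ⟨(integrable_map_measure hrm.aestronglyMeasurable hφ.aemeasurable).2 hint, ?_⟩
  rw [integral_map hφ.aemeasurable hrm.aestronglyMeasurable, map_measureReal_apply hφ hB]
  have hsum : ∑ m ∈ I, ∫ z, noiseExcess p (Module.finrank ℝ (modelSpace X m)) (W m) z
      ∂stdGaussian (EuclideanSpace ℝ (Fin n)) ≤ 4 * (mstar.card * Real.log p) := by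
    calc _ = ∑ m ∈ I, Real.exp (-weight p (modelSpace X m)) :=
          Finset.sum_congr rfl fun m hm =>
            integral_noiseExcess (hdim m hm) (hW m hm).2.2
      _ ≤ 1 + Real.log (p + 1) := by
          refine (Finset.sum_le_sum_of_subset_of_nonneg ?_
            fun m _ _ => (Real.exp_pos _).le).trans (sum_exp_neg_weight_le X)
          intro m hm
          exact Finset.mem_filter.2 ⟨Finset.mem_univ _, (Finset.mem_filter.1 hm).2.1⟩
      _ ≤ 4 * Real.log p := one_add_log_add_one_le hp
      _ ≤ 4 * (mstar.card * Real.log p) := by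
          have : (1 : ℝ) ≤ mstar.card := by exact_mod_cast hne.card_pos
          nlinarith
  -- In the constant, 4 comes from the sum of the weights, 192 exp 48 from the penalty of S*, and 7
  -- from the fourth moment.
  rw [oracleConst, inv_mul_le_iff₀ (by positivity)]
  refine hle.trans ?_
  have hbn : b * (s ^ 2 * n) ≤ s ^ 2 * (192 * Real.exp 48 * (mstar.card * Real.log p)) := by
    rw [le_div_iff₀ hn] at hb1
    have := mul_le_mul_of_nonneg_left hb1 (sq_nonneg s)
    linarith
  have h1 : c * K * (s ^ 2 * ∑ m ∈ I, ∫ z, noiseExcess p (Module.finrank ℝ (modelSpace X m))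
        (W m) z ∂stdGaussian (EuclideanSpace ℝ (Fin n)) + b * (s ^ 2 * n))
      ≤ c * K * (s ^ 2 * (4 * (mstar.card * Real.log p))
        + s ^ 2 * (192 * Real.exp 48 * (mstar.card * Real.log p))) := by
    gcongr
  have h2 : 0 ≤ c * K * (4 + 192 * Real.exp 48) := by positivity
  have h3 : 0 ≤ Real.log p * mstar.card * s ^ 2 := by positivity
  have h4 : 0 ≤ (‖f‖ ^ 2 + n * s ^ 2) * √((stdGaussian (EuclideanSpace ℝ (Fin n))).real
      ((fun z => f + s • z) ⁻¹' B)) := by positivity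
  have h5 := mul_nonneg h2 h4
  linarith

/-- On the event that the true model is among the candidates, the risk of the selected estimator
is controlled by the noise. -/
lemma exists_modelSpace_risk_le {Λ : Type*} {K α : ℝ} (hK : 1 < K) (hα : 0 < α) {Dmax : ℕ}
    (hDn : Dmax + 2 ≤ n) {X : Matrix (Fin n) (Fin p) ℝ} {mhat : Λ → Finset (Fin p)}
    {SS : Λ → Set (Submodule ℝ (EuclideanSpace ℝ (Fin n)))}
    (hmem : ∀ lam, modelSpace X (mhat lam) ∈ SS lam)
    (hsub : ∀ lam, SS lam ⊆ modelCollection X Dmax)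
    {f e : EuclideanSpace ℝ (Fin n)} {lam₀ : Λ}
    (hmin : ∀ lam, crit K α p (SS lam₀) (f + e) (projEst X (mhat lam₀) (f + e))
      ≤ crit K α p (SS lam) (f + e) (projEst X (mhat lam) (f + e)))
    {mstar : Finset (Fin p)} (hcard : mstar.card ≤ Dmax) (hf : f ∈ modelSpace X mstar)
    (hstar : mstar ∈ Set.range mhat) :
    ∃ T ∈ modelCollection X Dmax, ∀ W : Submodule ℝ (EuclideanSpace ℝ (Fin n)), T ≤ W → f ∈ W →
      ((∀ lam, SS lam ⊆ Set.range fun lam' => modelSpace X (mhat lam')) →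
        ‖f - projEst X (mhat lam₀) (f + e)‖ ^ 2 ≤ (1 - K⁻¹)⁻¹
          * (K * (noiseExcess p (Module.finrank ℝ T) W e
          + penDelta n (Module.finrank ℝ (modelSpace X mstar)) (weight p (modelSpace X mstar))
            / ((n : ℝ) - Module.finrank ℝ (modelSpace X mstar)) * ‖e‖ ^ 2))) ∧
      ‖f - projEst X (mhat lam₀) (f + e)‖ ^ 2 ≤ 2 * ((1 - K⁻¹)⁻¹ + α⁻¹)
          * (K * (noiseExcess p (Module.finrank ℝ T) W e
          + penDelta n (Module.finrank ℝ (modelSpace X mstar)) (weight p (modelSpace X mstar))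
            / ((n : ℝ) - Module.finrank ℝ (modelSpace X mstar)) * ‖e‖ ^ 2)) := by
  have hfin : ∀ lam, (SS lam).Finite := fun lam =>
    (finite_modelCollection X Dmax).subset (hsub lam)
  have hlt : ∀ T ∈ modelCollection X Dmax, Module.finrank ℝ T < n := by
    rintro T ⟨m, hm, rfl⟩
    have := finrank_modelSpace_le_card X m
    omega
  have hK1 : 0 < 1 - K⁻¹ := sub_pos.2 (inv_lt_one_of_one_lt₀ hK)
  obtain ⟨lam', rfl⟩ := hstar
  set g := projEst X (mhat lam₀) (f + e) with hg
  obtain ⟨T, hT, hcrit⟩ := exists_crit_eq (p := p) K α (hfin lam₀) ⟨_, hmem lam₀⟩ (f + e) g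
  refine ⟨T, hsub _ hT, fun W hTW hfW => ?_⟩
  have h := mul_norm_sub_sq_add_le (g := g) hK hf (hlt _ ⟨_, hcard, rfl⟩) hTW hfW
    (hlt _ (hsub _ hT))
    (hcrit.trans_le ((hmin lam').trans (crit_projEst_le (hfin lam') (hmem lam') (f + e))))
  set R := K * (noiseExcess p (Module.finrank ℝ T) W e
    + penDelta n (Module.finrank ℝ (modelSpace X (mhat lam')))
      (weight p (modelSpace X (mhat lam')))
      / ((n : ℝ) - Module.finrank ℝ (modelSpace X (mhat lam'))) * ‖e‖ ^ 2)
  have h1 : ‖f - T.starProjection g‖ ^ 2 ≤ (1 - K⁻¹)⁻¹ * R := by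
    rw [le_inv_mul_iff₀ hK1]
    exact (le_add_of_nonneg_right (by positivity)).trans h
  have h2 : ‖g - T.starProjection g‖ ^ 2 ≤ α⁻¹ * R := by
    rw [le_inv_mul_iff₀ hα]
    exact (le_add_of_nonneg_left (by positivity)).trans h
  refine ⟨fun hrange => ?_, ?_⟩
  · rwa [starProjection_projEst_eq_self hα hfin hmem hmin (hrange _ hT) hcrit] at h1
  -- Without Π_T g = g, the triangle inequality and (a + b)² ≤ 2(a² + b²) add the two bounds, hence
  -- the α⁻¹.
  · have h3 : ‖f - g‖ ≤ ‖f - T.starProjection g‖ + ‖g - T.starProjection g‖ := by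
      rw [norm_sub_rev g]
      exact norm_sub_le_norm_sub_add_norm_sub _ _ _
    have h4 := pow_le_pow_left₀ (norm_nonneg _) h3 2
    have h5 := add_sq_le (a := ‖f - T.starProjection g‖) (b := ‖g - T.starProjection g‖)
    linarith

end Risk

end EstimatorSelection

/-- `SS lam y` is the (random) collection of approximation spaces attached to the estimator `lam`,
`mhat lam y` the selected set of predictors and `lamhat y` the selected index, when the observation
is `y`. The constant `C₀` depends on `K` and `κ` only; `C α` depends on `K`, `κ` and `α` only. -/
theorem corollary4 (K κ : ℝ) (hK : 1 < K) (hκ0 : 0 < κ) (hκ1 : κ < 1) :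
    ∃ C₀ : ℝ, 0 < C₀ ∧ ∃ C : ℝ → ℝ, (∀ α : ℝ, 0 < α → 0 < C α) ∧
      ∀ (α : ℝ), 0 < α →
      ∀ (n p Dmax : ℕ), 2 ≤ p → 1 ≤ Dmax → Dmax + 2 ≤ n →
        (Dmax : ℝ) ≤ κ * n / (2 * Real.log p) →
      ∀ (X : Matrix (Fin n) (Fin p) ℝ) (f : EuclideanSpace ℝ (Fin n)) (σ : ℝ≥0)
        (Ω : Type*) [MeasurableSpace Ω] (P : Measure Ω) [IsProbabilityMeasure P]
        (ε : Fin n → Ω → ℝ),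
        (∀ i, HasLaw (ε i) (gaussianReal 0 (σ ^ 2)) P) → iIndepFun ε P →
      ∀ (Λ : Type*) [Finite Λ] (mhat : Λ → EuclideanSpace ℝ (Fin n) → Finset (Fin p)),
        (∀ lam m, MeasurableSet {y | mhat lam y = m}) →
        (∀ lam y, (mhat lam y).card ≤ Dmax) →
      ∀ (SS : Λ → EuclideanSpace ℝ (Fin n) → Set (Submodule ℝ (EuclideanSpace ℝ (Fin n)))),
        (∀ lam y, EstimatorSelection.modelSpace X (mhat lam y) ∈ SS lam y) →
        (∀ lam y, SS lam y ⊆ EstimatorSelection.modelCollection X Dmax) →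
      ∀ (lamhat : EuclideanSpace ℝ (Fin n) → Λ),
        (∀ lam, MeasurableSet {y | lamhat y = lam}) →
        (∀ y lam,
          EstimatorSelection.crit K α p (SS (lamhat y) y) y
              (EstimatorSelection.projEst X (mhat (lamhat y) y) y)
            ≤ EstimatorSelection.crit K α p (SS lam y) y
              (EstimatorSelection.projEst X (mhat lam y) y)) →
      ∀ (mstar : Finset (Fin p)), mstar.Nonempty → mstar.card ≤ Dmax →
        f ∈ EstimatorSelection.modelSpace X mstar →
      ∀ (Y : Ω → EuclideanSpace ℝ (Fin n)), Y = EstimatorSelection.observation f ε →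
        Integrable (fun ω => ‖f - EstimatorSelection.projEst X
          (mhat (lamhat (Y ω)) (Y ω)) (Y ω)‖ ^ 2) P ∧
        ((∀ lam y, SS lam y ⊆
            Set.range fun lam' => EstimatorSelection.modelSpace X (mhat lam' y)) →
          C₀ * ∫ ω, ‖f - EstimatorSelection.projEst X
              (mhat (lamhat (Y ω)) (Y ω)) (Y ω)‖ ^ 2 ∂P
            ≤ Real.log p * mstar.card * (σ : ℝ) ^ 2
              + (‖f‖ ^ 2 + n * (σ : ℝ) ^ 2)
                * √(P.real {ω | mstar ∉ Set.range fun lam => mhat lam (Y ω)})) ∧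
        C α * ∫ ω, ‖f - EstimatorSelection.projEst X
              (mhat (lamhat (Y ω)) (Y ω)) (Y ω)‖ ^ 2 ∂P
            ≤ Real.log p * mstar.card * (σ : ℝ) ^ 2
              + (‖f‖ ^ 2 + n * (σ : ℝ) ^ 2)
                * √(P.real {ω | mstar ∉ Set.range fun lam => mhat lam (Y ω)}) := by
  have hK0 : 0 ≤ K := by linarith
  have hK1 : 0 < 1 - K⁻¹ := sub_pos.2 (inv_lt_one_of_one_lt₀ hK)
  refine ⟨EstimatorSelection.oracleConst K (1 - K⁻¹)⁻¹,
    EstimatorSelection.oracleConst_pos hK0 (by positivity),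
    fun α => EstimatorSelection.oracleConst K (2 * ((1 - K⁻¹)⁻¹ + α⁻¹)),
    fun α hα => EstimatorSelection.oracleConst_pos hK0 (by positivity), ?_⟩
  intro α hα n p Dmax hp hD1 hDn hDp X f σ Ω _ P _ ε hε hind Λ _ mhat hmhat hmcard SS hmem hsub
    lamhat hlamhat hmin mstar hne hcard hf Y hY
  have hlaw := EstimatorSelection.hasLaw_observation f hε hind
  rw [← hY] at hlaw
  -- Only κ < 1 matters for the constants, which are therefore uniform in κ.
  have hDp' : Dmax * Real.log p ≤ (n : ℝ) / 2 := by
    have hlog : 0 < Real.log p := Real.log_pos (by exact_mod_cast hp)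
    rw [le_div_iff₀ (by positivity)] at hDp
    have : κ * n ≤ n := mul_le_of_le_one_left n.cast_nonneg hκ1.le
    linarith
  have hM : ∀ m, MeasurableSet {y | mhat (lamhat y) y = m} := by
    intro m
    have : {y | mhat (lamhat y) y = m} = ⋃ lam, {y | lamhat y = lam} ∩ {y | mhat lam y = m} := by
      ext y
      simp
    rw [this]
    exact MeasurableSet.iUnion fun lam => (hlamhat lam).inter (hmhat lam m)
  set B : Set (EuclideanSpace ℝ (Fin n)) := {y | mstar ∉ Set.range fun lam => mhat lam y} with hB
  have hBm : MeasurableSet B := by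
    have : B = (⋃ lam, {y | mhat lam y = mstar})ᶜ := by
      ext y
      simp [hB]
    rw [this]
    exact (MeasurableSet.iUnion fun lam => hmhat lam mstar).compl
  have hrisk : ∀ y, y ∉ B → ∀ e, y = f + e → _ := fun y hy e he =>
    EstimatorSelection.exists_modelSpace_risk_le (e := e) (mhat := fun lam => mhat lam y)
      (lam₀ := lamhat y) hK hα hDn (fun lam => hmem lam y) (fun lam => hsub lam y)
      (by subst he; exact hmin _) hcard hf (not_not.1 hy)
  have hprob : P.real {ω | mstar ∉ Set.range fun lam => mhat lam (Y ω)}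
      = ((stdGaussian (EuclideanSpace ℝ (Fin n))).map fun z => f + (σ : ℝ) • z).real B := by
    rw [← hlaw.map_eq, map_measureReal_apply_of_aemeasurable hlaw.aemeasurable hBm]
    rfl
  have hbound := EstimatorSelection.oracle_bound_stdGaussian (s := (σ : ℝ))
    (c := 2 * ((1 - K⁻¹)⁻¹ + α⁻¹)) hK (by positivity) hp hDn hDp' hM hne hcard hBm
    fun y hy e he => by
      obtain ⟨T, hT, h⟩ := hrisk y hy e he
      exact ⟨T, hT, fun W hTW hfW => by rw [he] at h ⊢; exact (h W hTW hfW).2⟩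
  have hint : ∫ ω, ‖f - EstimatorSelection.projEst X (mhat (lamhat (Y ω)) (Y ω)) (Y ω)‖ ^ 2 ∂P
      = ∫ y, ‖f - EstimatorSelection.projEst X (mhat (lamhat y) y) y‖ ^ 2
        ∂((stdGaussian (EuclideanSpace ℝ (Fin n))).map fun z => f + (σ : ℝ) • z) :=
    hlaw.integral_comp hbound.1.aestronglyMeasurable
  rw [hint, hprob]
  refine ⟨?_, fun hrange => ?_, hbound.2⟩
  · have h := hbound.1
    rw [← hlaw.map_eq] at h
    exact h.comp_aemeasurable hlaw.aemeasurable
  · refine (EstimatorSelection.oracle_bound_stdGaussian (s := (σ : ℝ)) hK (by positivity) hp hDn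
      hDp' hM hne hcard hBm fun y hy e he => ?_).2
    obtain ⟨T, hT, h⟩ := hrisk y hy e he
    exact ⟨T, hT, fun W hTW hfW => by
      rw [he] at h ⊢
      exact (h W hTW hfW).1 fun lam => hrange lam _⟩
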